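/- Let $X$ be a real or complex Banach space and let $T:X\to X$ be a bounded linear operator that is power bounded, i.e. $\sup_{n\ge 0}\|T^n\|<\infty$. For $Y\subseteq X$ write $\rho(x,Y)=\inf_{y\in Y}\|x-y\|$ (with $\inf\emptyset=\infty$), and call $a\in X$ a returning vector of $T$ if $\liminf_{n\to\infty}\|T^na-a\|=0$. Suppose there is a compact set $K\subseteq X$ such that $\liminf_{n\to\infty}\rho(T^nx,K)=0$ for every $x\in X$ with $\|x\|\le 1$. Let $L$ be the linear span of all returning vectors of $T$, and let $X_0=\{x\in X: T^nx\to 0\}$. Then $L$ is finite-dimensional, $T(L)\subseteq L$, and $\lim_{n\to\infty}\rho(T^nx,L)=0$ for every $x\in X$. Moreover $X_0$ is a $T$-invariant linear subspace, $X=X_0\oplus L$ as a topological direct sum, and $T^n=(T|_{X_0})^n\oplus(T|_L)^n$ with respect to this decomposition for every $n\ge 0$. -/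

import Mathlib

open Filter Topology

section

variable {𝕜 X : Type*} [RCLike 𝕜] [NormedAddCommGroup X] [NormedSpace 𝕜 X]

/-- `T` is power bounded: the norms of its powers are bounded. -/
def PowerBounded (T : X →L[𝕜] X) : Prop :=
  ∃ C : ℝ, ∀ n : ℕ, ‖T ^ n‖ ≤ C

/-- `K` is occasionally attracting for `T`: `liminf ρ(T ^ n x, K) = 0` for all `x` in the closed
unit ball. The distance takes values in `[0, ∞]`, so the empty set attracts nothing. -/
def OccasionallyAttracting (T : X →L[𝕜] X) (K : Set X) : Prop :=
  ∀ x : X, ‖x‖ ≤ 1 → liminf (fun n : ℕ => Metric.infEDist ((T ^ n) x) K) atTop = 0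

/-- `a` is a returning vector of `T`: `liminf ‖T ^ n a - a‖ = 0`, the liminf being taken
in `[0, ∞]`. -/
def IsReturning (T : X →L[𝕜] X) (a : X) : Prop :=
  liminf (fun n : ℕ => ‖(T ^ n) a - a‖ₑ) atTop = 0

/-- The subspace `X₀` of all `x` with `T ^ n x → 0`. -/
def vanishingSubspace (T : X →L[𝕜] X) : Submodule 𝕜 X where
  carrier := {x | Tendsto (fun n : ℕ => (T ^ n) x) atTop (𝓝 0)}
  zero_mem' := by simp
  add_mem' := by
    intro x y hx hy
    simpa only [Set.mem_setOf_eq, map_add, add_zero] using Tendsto.add hx hy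
  smul_mem' := by
    intro c x hx
    simpa only [Set.mem_setOf_eq, map_smul, smul_zero] using Tendsto.const_smul hx c

/-- `X` is the topological direct sum of the `T`-invariant subspaces `X₀` and `L`, and
`T ^ n = (T|X₀) ^ n ⊕ (T|L) ^ n` for all `n`. -/
def DecomposesAlong (T : X →L[𝕜] X) (X₀ L : Submodule 𝕜 X) : Prop :=
  X₀.IsTopCompl L ∧
  ∃ (h₀ : Set.MapsTo T X₀ X₀) (hL : Set.MapsTo T L L),
    ∀ (n : ℕ) (x₀ : X₀) (l : L),
      (T ^ n) ((x₀ : X) + (l : X)) =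
        (((T.restrict h₀) ^ n) x₀ : X) + (((T.restrict hL) ^ n) l : X)

end

/-!
Let `p x = limsup ‖T ^ n x‖`. Since `p (T x) = p x`, the operator `T` induces an isometry `S` of
the Banach space `Y` obtained by separating and completing `X` with respect to `p`, and `X₀` is the
kernel of the canonical map `X → Y`. The attracting compact set makes bounded sets relatively
compact in the space of `T`-orbits, and this property passes to `S`.

An isometry with this property admits no infinite strictly monotone chain of closed invariant
subspaces, because Riesz's lemma would turn the chain into a sequence of unit vectors whose orbits
are pairwise separated by `1 / 2`. So there is a maximal finite-dimensional invariant subspace `F`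
of `Y`. The isometry induced on `Y ⧸ F` makes some real quadratic polynomial `D` in it
non-invertible; if `D` were injective, the ranges of its powers would form a strictly decreasing
chain of closed invariant subspaces. Hence `D` has a kernel, which enlarges `F` unless `F = Y`.

As `Y` is finite-dimensional, `S ^ r n → 1` for some `r n → ∞`. The estimate
`‖T ^ r n a - a‖ ≤ p (T ^ r n x - x)`, valid for every limit point `a` of the orbit of `x`, shows
that all returning vectors return along this single sequence. They therefore form a subspace, which
the map `X → Y` sends isomorphically onto `Y`, so it is a complement of `X₀`.
-/

section Complexification

variable {M : Type*} [NormedAddCommGroup M] [NormedSpace ℝ M]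

variable (M) in
/-- The complexification of a real normed space `M`, realized as the space of real-linear maps
`ℂ → M`, on which `ℂ` acts by multiplication of the argument. It is a type synonym because
`ℂ →L[ℝ] M` carries no complex structure of its own. -/
def Complexified : Type _ := ℂ →L[ℝ] M

namespace Complexified

noncomputable instance : NormedAddCommGroup (Complexified M) :=
  inferInstanceAs (NormedAddCommGroup (ℂ →L[ℝ] M))

instance [CompleteSpace M] : CompleteSpace (Complexified M) :=
  inferInstanceAs (CompleteSpace (ℂ →L[ℝ] M))

noncomputable instance : FunLike (Complexified M) ℂ M :=
  inferInstanceAs (FunLike (ℂ →L[ℝ] M) ℂ M)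

instance : ContinuousLinearMapClass (Complexified M) ℝ ℂ M :=
  inferInstanceAs (ContinuousLinearMapClass (ℂ →L[ℝ] M) ℝ ℂ M)

@[simp] lemma add_apply (f g : Complexified M) (w : ℂ) : (f + g) w = f w + g w := rfl

@[simp] lemma zero_apply (w : ℂ) : (0 : Complexified M) w = 0 := rfl

noncomputable instance : SMul ℂ (Complexified M) :=
  ⟨fun z f => (f : ℂ →L[ℝ] M).comp (ContinuousLinearMap.mul ℝ ℂ z)⟩

@[simp] lemma smul_apply (z : ℂ) (f : Complexified M) (w : ℂ) : (z • f) w = f (z * w) := rfl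

noncomputable instance : Module ℂ (Complexified M) where
  one_smul f := DFunLike.ext _ _ fun w => by simp
  mul_smul z z' f := DFunLike.ext _ _ fun w => by simp [mul_left_comm, mul_assoc]
  smul_zero z := DFunLike.ext _ _ fun _ => by simp
  smul_add z f g := DFunLike.ext _ _ fun w => by simp
  add_smul z z' f := DFunLike.ext _ _ fun w => by simp [add_mul]
  zero_smul f := DFunLike.ext _ _ fun w => by simp

noncomputable instance : NormedSpace ℂ (Complexified M) where
  norm_smul_le z f := by
    rw [mul_comm]
    refine (ContinuousLinearMap.opNorm_comp_le (f : ℂ →L[ℝ] M)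
      (ContinuousLinearMap.mul ℝ ℂ z)).trans ?_
    gcongr
    · exact le_rfl
    · exact ContinuousLinearMap.opNorm_mul_apply_le ℝ ℂ z

lemma coe_smul_apply (r : ℝ) (f : Complexified M) (w : ℂ) : ((r : ℂ) • f) w = r • f w := by
  rw [smul_apply, ← Complex.real_smul, map_smul]

instance [Nontrivial M] : Nontrivial (Complexified M) := by
  obtain ⟨x, hx⟩ := exists_ne (0 : M)
  refine ⟨(Complex.reCLM.smulRight x : ℂ →L[ℝ] M), 0, fun h => hx ?_⟩
  simpa using (show (1 : ℂ).re • x = 0 from DFunLike.congr_fun h (1 : ℂ))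

/-- The complexification of bounded real-linear operators. -/
noncomputable def map : (M →L[ℝ] M) →ₐ[ℝ] (Complexified M →L[ℂ] Complexified M) where
  toFun T := LinearMap.mkContinuous
    { toFun := fun f => (T.comp (f : ℂ →L[ℝ] M) : ℂ →L[ℝ] M)
      map_add' := fun f g => T.comp_add (f : ℂ →L[ℝ] M) (g : ℂ →L[ℝ] M)
      map_smul' := fun _ _ => rfl } ‖T‖
    fun f => T.opNorm_comp_le (f : ℂ →L[ℝ] M)
  map_one' := rfl
  map_mul' _ _ := rfl
  map_zero' := rfl
  map_add' _ _ := rfl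
  commutes' r := ContinuousLinearMap.ext fun f => DFunLike.ext _ _ fun w =>
    (coe_smul_apply r f w).symm

end Complexified

open Polynomial in
/-- The roots of the quadratic are a spectral value of the complexification of `T` and its
conjugate. -/
theorem exists_not_isUnit_quadratic [CompleteSpace M] [Nontrivial M] (T : M →L[ℝ] M) :
    ∃ a b : ℝ, ¬ IsUnit (T ^ 2 - a • T + b • (1 : M →L[ℝ] M)) := by
  obtain ⟨z, hz⟩ := spectrum.nonempty (Complexified.map T)
  refine ⟨2 * z.re, Complex.normSq z, fun hunit => ?_⟩
  let q : ℝ[X] := X ^ 2 - (2 * z.re) • X + Complex.normSq z • 1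
  have hqT : aeval T q = T ^ 2 - (2 * z.re) • T + Complex.normSq z • (1 : M →L[ℝ] M) := by
    simp [q]
  have hroot : aeval z q = 0 := by
    simp only [q, map_add, map_sub, map_pow, map_smul, map_one, aeval_X, Complex.real_smul,
      ← Complex.add_conj, ← Complex.mul_conj]
    ring
  have hsing : (0 : ℂ) ∈ spectrum ℂ (Complexified.map (aeval T q)) := by
    rw [← aeval_algHom_apply, ← aeval_map_algebraMap ℂ]
    exact spectrum.subset_polynomial_aeval _ _ ⟨z, hz, (eval_map_algebraMap q z).trans hroot⟩
  rw [hqT, spectrum.zero_mem_iff] at hsing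
  exact hsing (hunit.map Complexified.map)

end Complexification

section Powers

variable {𝕜 X Y : Type*} [NormedField 𝕜] [SeminormedAddCommGroup X] [NormedSpace 𝕜 X]
  [SeminormedAddCommGroup Y] [NormedSpace 𝕜 Y] {T : X →L[𝕜] X} {S : Y →L[𝕜] Y}

lemma mapsTo_pow {F : Set X} (hF : Set.MapsTo T F F) (n : ℕ) : Set.MapsTo (T ^ n) F F := by
  simpa only [FunLike.coe_pow_eq_iterate] using hF.iterate n

lemma semiconj_pow {π : X → Y} (h : Function.Semiconj π T S) (n : ℕ) :
    Function.Semiconj π ⇑(T ^ n) ⇑(S ^ n) := by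
  simpa only [FunLike.coe_pow_eq_iterate] using h.iterate_right n

lemma isometry_pow (hT : Isometry T) (n : ℕ) : Isometry (T ^ n) := by
  induction n with
  | zero => exact isometry_id
  | succ n ih => exact ih.comp hT

lemma norm_pow_apply (hT : Isometry T) (n : ℕ) (x : X) : ‖(T ^ n) x‖ = ‖x‖ :=
  (isometry_pow hT n).norm_map_of_map_zero (map_zero _) x

lemma strictMono_le_add_self_sub {m : ℕ → ℕ} (hm : StrictMono m) (n : ℕ) :
    n ≤ m (n + n) - m n :=
  Nat.le_sub_of_add_le (hm.add_le_nat n n)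

lemma tendsto_pow_sub_self (hT : Isometry T) {m : ℕ → ℕ} (hm : StrictMono m) {x y : X}
    (hy : Tendsto (fun n => (T ^ m n) x) atTop (𝓝 y)) :
    Tendsto (fun n => (T ^ (m (n + n) - m n)) x) atTop (𝓝 x) := by
  have hdouble : Tendsto (fun n : ℕ => n + n) atTop atTop :=
    tendsto_atTop_mono (fun n => Nat.le_add_left n n) tendsto_id
  have hdist : Tendsto (fun n => dist ((T ^ m (n + n)) x) ((T ^ m n) x)) atTop (𝓝 0) := by
    simpa using (hy.comp hdouble).dist hy
  refine tendsto_iff_dist_tendsto_zero.2 (hdist.congr fun n => ?_)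
  have hadd : m n + (m (n + n) - m n) = m (n + n) :=
    Nat.add_sub_cancel' (hm.monotone (Nat.le_add_left n n))
  rw [← (isometry_pow hT (m n)).dist_eq _ x, ← mul_apply_eq_comp, ← pow_add, hadd]

end Powers

section OrbitCompact

section NormedField

variable {𝕜 X Y : Type*} [NormedField 𝕜] [NormedAddCommGroup X] [NormedSpace 𝕜 X]
  [NormedAddCommGroup Y] [NormedSpace 𝕜 Y] {T : X →L[𝕜] X} {S : Y →L[𝕜] Y}

/-- Every bounded sequence has a subsequence which converges after each of its terms has been
moved along its `T`-orbit. For an isometry this says that bounded sets are relatively compact in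
the space of orbits. -/
def OrbitCompact (T : X →L[𝕜] X) : Prop :=
  ∀ (R : ℝ) (x : ℕ → X), (∀ n, ‖x n‖ ≤ R) →
    ∃ (k φ : ℕ → ℕ) (y : X), StrictMono φ ∧
      Tendsto (fun n => (T ^ k n) (x (φ n))) atTop (𝓝 y)

lemma OrbitCompact.exists_strictMono_tendsto_pow (hO : OrbitCompact T) {R : ℝ} {x : X}
    (hR : ∀ n, ‖(T ^ n) x‖ ≤ R) :
    ∃ (m : ℕ → ℕ) (y : X), StrictMono m ∧ Tendsto (fun n => (T ^ m n) x) atTop (𝓝 y) := by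
  obtain ⟨k, φ, y, hφ, hy⟩ := hO R (fun n => (T ^ n) x) hR
  have htop : Tendsto (fun n => k n + φ n) atTop atTop :=
    tendsto_atTop_mono (fun n => Nat.le_add_left _ _) hφ.tendsto_atTop
  obtain ⟨ψ, hψ, hm⟩ := strictMono_subseq_of_tendsto_atTop htop
  refine ⟨_, y, hm, (hy.comp hψ.tendsto_atTop).congr fun n => ?_⟩
  simp only [Function.comp_apply, pow_add, mul_apply_eq_comp]

lemma OrbitCompact.exists_dist_pow_lt (hO : OrbitCompact T) {R : ℝ} {f : ℕ → X}
    (hR : ∀ n, ‖f n‖ ≤ R) {ε : ℝ} (hε : 0 < ε) :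
    ∃ m n, m < n ∧ ∃ k l, dist ((T ^ k) (f m)) ((T ^ l) (f n)) < ε := by
  obtain ⟨k, φ, y, hφ, hy⟩ := hO R f hR
  obtain ⟨N, hN⟩ := Metric.cauchySeq_iff.1 hy.cauchySeq ε hε
  exact ⟨φ N, φ (N + 1), hφ N.lt_succ_self, k N, k (N + 1), hN N le_rfl (N + 1) N.le_succ⟩

lemma OrbitCompact.of_semiconj (hO : OrbitCompact T) (hS : Isometry S) (π : X →L[𝕜] Y)
    (hπ : Function.Semiconj π T S)
    (happrox : ∀ y, ∀ ε > 0, ∃ (n : ℕ) (x : X), ‖x‖ ≤ ‖y‖ + 1 ∧ dist (π x) ((S ^ n) y) < ε) :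
    OrbitCompact S := by
  intro R y hy
  choose j x hx hxy using fun n : ℕ => happrox (y n) (1 / ((n : ℝ) + 1)) Nat.one_div_pos_of_nat
  obtain ⟨k, φ, z, hφ, hz⟩ := hO (R + 1) x fun n => (hx n).trans (by gcongr; exact hy n)
  refine ⟨fun n => k n + j (φ n), φ, π z, hφ, ?_⟩
  have hclose : Tendsto (fun n => dist (π ((T ^ k n) (x (φ n)))) ((S ^ (k n + j (φ n))) (y (φ n))))
      atTop (𝓝 0) := by
    refine squeeze_zero (fun _ => dist_nonneg) (fun n => ?_)
      (tendsto_one_div_add_atTop_nhds_zero_nat.comp hφ.tendsto_atTop)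
    rw [semiconj_pow hπ, pow_add, mul_apply_eq_comp, (isometry_pow hS _).dist_eq]
    exact (hxy _).le
  exact ((π.continuous.tendsto z).comp hz).congr_dist hclose

lemma OrbitCompact.image_eq [CompleteSpace X] (hO : OrbitCompact T) (hT : Isometry T) {F : Set X}
    (hF : IsClosed F) (hTF : Set.MapsTo T F F) : T '' F = F := by
  refine hTF.image_subset.antisymm fun x hx => ?_
  obtain ⟨m, y, hm, hy⟩ := hO.exists_strictMono_tendsto_pow fun n => (norm_pow_apply hT n x).le
  refine (hT.isClosedEmbedding.isClosedMap F hF).mem_of_tendsto (tendsto_pow_sub_self hT hm hy) ?_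
  filter_upwards [eventually_ge_atTop 1] with n hn
  have hpos : m (n + n) - m n ≠ 0 :=
    Nat.ne_zero_of_lt (hn.trans (strictMono_le_add_self_sub hm n))
  rw [← mul_pow_sub_one hpos, mul_apply_eq_comp]
  exact Set.mem_image_of_mem T (mapsTo_pow hTF _ hx)

lemma OrbitCompact.infDist_map [CompleteSpace X] (hO : OrbitCompact T) (hT : Isometry T) {F : Set X}
    (hF : IsClosed F) (hTF : Set.MapsTo T F F) (x : X) :
    Metric.infDist (T x) F = Metric.infDist x F := by
  conv_lhs => rw [← hO.image_eq hT hF hTF]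
  exact Metric.infDist_image hT

lemma OrbitCompact.infDist_pow [CompleteSpace X] (hO : OrbitCompact T) (hT : Isometry T) {F : Set X}
    (hF : IsClosed F) (hTF : Set.MapsTo T F F) (n : ℕ) (x : X) :
    Metric.infDist ((T ^ n) x) F = Metric.infDist x F := by
  induction n with
  | zero => rfl
  | succ n ih => rw [pow_succ', mul_apply_eq_comp, hO.infDist_map hT hF hTF, ih]

end NormedField

variable {𝕜 X : Type*} [RCLike 𝕜] [NormedAddCommGroup X] [NormedSpace 𝕜 X] {T : X →L[𝕜] X}

lemma exists_norm_eq_one_le_infDist {V W : Submodule 𝕜 X} (hV : IsClosed (V : Set X))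
    (hVW : V < W) {r : ℝ} (hr : r < 1) : ∃ x ∈ W, ‖x‖ = 1 ∧ r ≤ Metric.infDist x V := by
  obtain ⟨hle, w, hwW, hwV⟩ := SetLike.lt_iff_le_and_exists.1 hVW
  have hclosed : IsClosed ((V.comap W.subtype : Submodule 𝕜 W) : Set W) := hV.preimage_val
  obtain ⟨x, -, hx1, hx⟩ := riesz_lemma_of_lt_one hclosed ⟨⟨w, hwW⟩, hwV⟩ hr
  refine ⟨x, x.2, hx1, (Metric.le_infDist V.nonempty).2 fun y hy => ?_⟩
  rw [dist_eq_norm]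
  exact hx ⟨y, hle hy⟩ hy

lemma OrbitCompact.exists_le_succ_of_antitone [CompleteSpace X] (hO : OrbitCompact T)
    (hT : Isometry T) {V : ℕ → Submodule 𝕜 X} (hV : ∀ n, IsClosed (V n : Set X))
    (hTV : ∀ n, Set.MapsTo T (V n) (V n)) (hanti : Antitone V) : ∃ n, V n ≤ V (n + 1) := by
  by_contra! h
  choose f hfV hf1 hf using fun n => exists_norm_eq_one_le_infDist (hV (n + 1))
    (lt_of_le_not_ge (hanti n.le_succ) (h n)) one_half_lt_one
  obtain ⟨m, n, hmn, k, l, hlt⟩ := hO.exists_dist_pow_lt (fun n => (hf1 n).le) one_half_pos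
  refine hlt.not_ge ?_
  calc 1 / 2 ≤ Metric.infDist (f m) (V (m + 1)) := hf m
    _ = Metric.infDist ((T ^ k) (f m)) (V (m + 1)) :=
      (hO.infDist_pow hT (hV _) (hTV _) k (f m)).symm
    _ ≤ dist ((T ^ k) (f m)) ((T ^ l) (f n)) :=
      Metric.infDist_le_dist_of_mem (mapsTo_pow (hTV _) l (hanti hmn (hfV n)))

lemma OrbitCompact.exists_succ_le_of_monotone [CompleteSpace X] (hO : OrbitCompact T)
    (hT : Isometry T) {V : ℕ → Submodule 𝕜 X} (hV : ∀ n, IsClosed (V n : Set X))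
    (hTV : ∀ n, Set.MapsTo T (V n) (V n)) (hmono : Monotone V) : ∃ n, V (n + 1) ≤ V n := by
  by_contra! h
  choose f hfV hf1 hf using fun n => exists_norm_eq_one_le_infDist (hV n)
    (lt_of_le_not_ge (hmono n.le_succ) (h n)) one_half_lt_one
  obtain ⟨m, n, hmn, k, l, hlt⟩ := hO.exists_dist_pow_lt (fun n => (hf1 n).le) one_half_pos
  refine hlt.not_ge ?_
  calc 1 / 2 ≤ Metric.infDist (f n) (V n) := hf n
    _ = Metric.infDist ((T ^ l) (f n)) (V n) := (hO.infDist_pow hT (hV _) (hTV _) l (f n)).symm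
    _ ≤ dist ((T ^ l) (f n)) ((T ^ k) (f m)) :=
      Metric.infDist_le_dist_of_mem (mapsTo_pow (hTV _) k (hmono hmn (hfV m)))
    _ = dist ((T ^ k) (f m)) ((T ^ l) (f n)) := dist_comm _ _

lemma OrbitCompact.exists_antilipschitzWith (hO : OrbitCompact T) (hT : Isometry T)
    {D : X →L[𝕜] X} (hD : Commute D T) (hinj : Function.Injective D) :
    ∃ K, AntilipschitzWith K D := by
  rw [antilipschitzWith_iff_exists_mul_le_norm]
  by_contra! h
  have hsmall : ∀ n : ℕ, ∃ x, ‖x‖ = 1 ∧ ‖D x‖ ≤ 1 / ((n : ℝ) + 1) := fun n => by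
    obtain ⟨x, hx⟩ := h (1 / ((n : ℝ) + 1)) Nat.one_div_pos_of_nat
    have hx0 : x ≠ 0 := by rintro rfl; simp at hx
    refine ⟨(‖x‖⁻¹ : 𝕜) • x, norm_smul_inv_norm hx0, ?_⟩
    rw [map_smul, norm_smul, norm_inv, RCLike.norm_coe_norm, inv_mul_le_iff₀ (norm_pos_iff.2 hx0),
      mul_comm]
    exact hx.le
  choose x hx1 hxD using hsmall
  obtain ⟨k, φ, y, hφ, hy⟩ := hO 1 x fun n => (hx1 n).le
  have hy1 : ‖y‖ = 1 := by
    refine tendsto_nhds_unique hy.norm ?_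
    simp only [norm_pow_apply hT, hx1, tendsto_const_nhds]
  have hlim : Tendsto (fun n => D ((T ^ k n) (x (φ n)))) atTop (𝓝 0) := by
    refine squeeze_zero_norm (fun n => ?_)
      (tendsto_one_div_add_atTop_nhds_zero_nat.comp hφ.tendsto_atTop)
    rw [← mul_apply_eq_comp, (hD.pow_right (k n)).eq, mul_apply_eq_comp, norm_pow_apply hT]
    exact hxD _
  have hDy : D y = 0 := tendsto_nhds_unique ((D.continuous.tendsto y).comp hy) hlim
  rw [(map_eq_zero_iff D hinj).1 hDy, norm_zero] at hy1
  exact zero_ne_one hy1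

lemma OrbitCompact.surjective_of_injective [CompleteSpace X] (hO : OrbitCompact T)
    (hT : Isometry T) {D : X →L[𝕜] X} (hD : Commute D T) (hinj : Function.Injective D) :
    Function.Surjective D := by
  have hinj_pow : ∀ n, Function.Injective ⇑(D ^ n) := fun n => by
    simpa only [FunLike.coe_pow_eq_iterate] using hinj.iterate n
  have hclosed : ∀ n, IsClosed ((D ^ n).range : Set X) := fun n => by
    obtain ⟨K, hK⟩ := hO.exists_antilipschitzWith hT (hD.pow_left n) (hinj_pow n)
    exact hK.isClosed_range (D ^ n).uniformContinuous
  have hinv : ∀ n, Set.MapsTo T (D ^ n).range (D ^ n).range := by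
    rintro n _ ⟨x, rfl⟩
    exact ⟨T x, DFunLike.congr_fun (hD.pow_left n).eq x⟩
  have hanti : Antitone fun n => (D ^ n).range := antitone_nat_of_succ_le fun n => by
    rintro _ ⟨x, rfl⟩
    exact ⟨D x, by rw [pow_succ]; rfl⟩
  obtain ⟨n, hn⟩ := hO.exists_le_succ_of_antitone hT hclosed hinv hanti
  intro z
  obtain ⟨w, hw⟩ := hn ⟨z, rfl⟩
  rw [pow_succ] at hw
  exact ⟨w, hinj_pow n hw⟩

lemma OrbitCompact.exists_quadratic_eigenvector [CompleteSpace X] [Nontrivial X]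
    (hO : OrbitCompact T) (hT : Isometry T) :
    ∃ (a b : 𝕜) (x : X), x ≠ 0 ∧ T (T x) - a • T x + b • x = 0 := by
  let _ : NormedSpace ℝ X := NormedSpace.restrictScalars ℝ 𝕜 X
  have : IsScalarTower ℝ 𝕜 X := RestrictScalars.isScalarTower ℝ 𝕜 X
  obtain ⟨a, b, hab⟩ := exists_not_isUnit_quadratic (T.restrictScalars ℝ)
  let D : X →L[𝕜] X := T ^ 2 - (a : 𝕜) • T + (b : 𝕜) • 1
  have hD : Commute D T :=
    ((Commute.pow_self T 2).sub_left ((Commute.refl T).smul_left _)).add_left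
      ((Commute.one_left T).smul_left _)
  have hDa : ⇑((T.restrictScalars ℝ) ^ 2 - a • T.restrictScalars ℝ + b • (1 : X →L[ℝ] X)) = D := by
    ext x
    simp [D, pow_two]
  have hninj : ¬ Function.Injective D := fun hinj => by
    rw [ContinuousLinearMap.isUnit_iff_bijective, hDa] at hab
    exact hab ⟨hinj, hO.surjective_of_injective hT hD hinj⟩
  obtain ⟨x, hDx, hx⟩ : ∃ x, D x = 0 ∧ x ≠ 0 := by
    simpa only [injective_iff_map_eq_zero, not_forall, exists_prop] using hninj
  exact ⟨a, b, x, hx, by simpa [D, pow_two] using hDx⟩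

end OrbitCompact

section Quotient

section NormedField

variable {𝕜 Y : Type*} [NormedField 𝕜] [NormedAddCommGroup Y] [NormedSpace 𝕜 Y] {T : Y →L[𝕜] Y}
  {F : Submodule 𝕜 Y}

/-- The operator induced by `T` on the quotient by the invariant subspace `F`. -/
noncomputable def quotientOperator (T : Y →L[𝕜] Y) (F : Submodule 𝕜 Y)
    (hTF : Set.MapsTo T F F) : Y ⧸ F →L[𝕜] Y ⧸ F :=
  F.liftQL (F.mkQL.comp T) fun x hx => by simpa using hTF hx

lemma semiconj_mkQL (hTF : Set.MapsTo T F F) :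
    Function.Semiconj F.mkQL T (quotientOperator T F hTF) := fun _ => rfl

lemma norm_mkQL_eq_infDist (F : Submodule 𝕜 Y) (x : Y) : ‖F.mkQL x‖ = Metric.infDist x F :=
  QuotientAddGroup.norm_mk (S := F.toAddSubgroup) x

lemma OrbitCompact.isometry_quotientOperator [CompleteSpace Y] [hF : IsClosed (F : Set Y)]
    (hO : OrbitCompact T) (hT : Isometry T) (hTF : Set.MapsTo T F F) :
    Isometry (quotientOperator T F hTF) := by
  refine AddMonoidHomClass.isometry_of_norm _ fun q => ?_
  obtain ⟨x, rfl⟩ := F.mkQ_surjective q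
  change ‖F.mkQL (T x)‖ = ‖F.mkQL x‖
  rw [norm_mkQL_eq_infDist, norm_mkQL_eq_infDist, hO.infDist_map hT hF hTF]

lemma OrbitCompact.quotientOperator [CompleteSpace Y] [IsClosed (F : Set Y)]
    (hO : OrbitCompact T) (hT : Isometry T) (hTF : Set.MapsTo T F F) :
    OrbitCompact (quotientOperator T F hTF) := by
  refine hO.of_semiconj (hO.isometry_quotientOperator hT hTF) F.mkQL (semiconj_mkQL hTF)
    fun q ε hε => ?_
  obtain ⟨x, rfl, hx⟩ := Submodule.Quotient.norm_mk_lt q one_pos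
  exact ⟨0, x, hx.le, by simpa using hε⟩

lemma mapsTo_sup_span_pair (hTF : Set.MapsTo T F F) {a b : 𝕜} {x : Y}
    (hx : T (T x) - a • T x + b • x ∈ F) :
    Set.MapsTo T (F ⊔ Submodule.span 𝕜 {x, T x} : Submodule 𝕜 Y)
      (F ⊔ Submodule.span 𝕜 {x, T x} : Submodule 𝕜 Y) := by
  have hspan : ∀ y ∈ ({x, T x} : Set Y), y ∈ F ⊔ Submodule.span 𝕜 {x, T x} := fun y hy =>
    Submodule.mem_sup_right (Submodule.subset_span hy)
  have hxmem := hspan x (by simp)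
  have hTxmem := hspan (T x) (by simp)
  have hle : F ⊔ Submodule.span 𝕜 {x, T x} ≤
      (F ⊔ Submodule.span 𝕜 {x, T x}).comap (T : Y →ₗ[𝕜] Y) := by
    refine sup_le (fun y hy => Submodule.mem_sup_left (hTF hy)) (Submodule.span_le.2 ?_)
    rintro y (rfl | rfl)
    · exact hTxmem
    · have hsum := add_mem (Submodule.mem_sup_left hx)
        (sub_mem (Submodule.smul_mem _ a hTxmem) (Submodule.smul_mem _ b hxmem))
      simpa using hsum
  exact hle

end NormedField

variable {𝕜 Y : Type*} [RCLike 𝕜] [NormedAddCommGroup Y] [NormedSpace 𝕜 Y] {T : Y →L[𝕜] Y}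
  {F : Submodule 𝕜 Y}

lemma OrbitCompact.exists_notMem_quadratic_mem [CompleteSpace Y] [hF : IsClosed (F : Set Y)]
    (hO : OrbitCompact T) (hT : Isometry T) (hTF : Set.MapsTo T F F) (hne : F ≠ ⊤) :
    ∃ (a b : 𝕜) (x : Y), x ∉ F ∧ T (T x) - a • T x + b • x ∈ F := by
  have : Nontrivial (Y ⧸ F) := Submodule.Quotient.nontrivial_iff.2 hne
  obtain ⟨a, b, q, hq, hab⟩ := (hO.quotientOperator hT hTF).exists_quadratic_eigenvector
    (hO.isometry_quotientOperator hT hTF)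
  obtain ⟨x, rfl⟩ := Submodule.Quotient.mk_surjective F q
  exact ⟨a, b, x, fun hx => hq ((Submodule.Quotient.mk_eq_zero F).2 hx),
    (Submodule.Quotient.mk_eq_zero F).1 hab⟩

lemma OrbitCompact.exists_maximal_finiteDimensional [CompleteSpace Y] (hO : OrbitCompact T)
    (hT : Isometry T) :
    ∃ F, Maximal (fun F : Submodule 𝕜 Y => FiniteDimensional 𝕜 F ∧ Set.MapsTo T F F) F := by
  let P := {F : Submodule 𝕜 Y // FiniteDimensional 𝕜 F ∧ Set.MapsTo T F F}
  have hwf : WellFoundedGT P := by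
    rw [WellFoundedGT, isWellFounded_iff, RelEmbedding.wellFounded_iff_isEmpty]
    refine ⟨fun V => ?_⟩
    have hmono : StrictMono V := strictMono_nat_of_lt_succ fun n => V.map_rel_iff.2 n.lt_succ_self
    obtain ⟨n, hn⟩ := hO.exists_succ_le_of_monotone hT (V := fun n => (V n).1)
      (fun n => have := (V n).2.1; (V n).1.closed_of_finiteDimensional) (fun n => (V n).2.2)
      hmono.monotone
    exact (hmono n.lt_succ_self).not_ge hn
  obtain ⟨F, -, hF⟩ := exists_maximal_ge_of_wellFoundedGT (fun _ : P => True)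
    (a := ⟨⊥, inferInstance, by simp [Set.MapsTo]⟩) trivial
  exact ⟨F, F.2, fun G hG => hF.2 (y := ⟨G, hG⟩) trivial⟩

theorem OrbitCompact.finiteDimensional [CompleteSpace Y] (hO : OrbitCompact T)
    (hT : Isometry T) : FiniteDimensional 𝕜 Y := by
  obtain ⟨F, ⟨hFfd, hTF⟩, hmax⟩ := hO.exists_maximal_finiteDimensional hT
  have hF : IsClosed (F : Set Y) := F.closed_of_finiteDimensional
  by_cases htop : F = ⊤
  · exact Module.finite_def.2 (htop ▸ (Module.Finite.iff_fg.1 hFfd))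
  obtain ⟨a, b, x, hxF, hx⟩ := hO.exists_notMem_quadratic_mem hT hTF htop
  have hspan : FiniteDimensional 𝕜 (Submodule.span 𝕜 {x, T x}) :=
    FiniteDimensional.span_of_finite 𝕜 (Set.toFinite _)
  exact absurd (hmax ⟨Submodule.finiteDimensional_sup F _, mapsTo_sup_span_pair hTF hx⟩ le_sup_left
    (Submodule.mem_sup_right (Submodule.subset_span (Set.mem_insert x _)))) hxF

end Quotient

section AsymptoticNorm

variable {𝕜 X : Type*} [RCLike 𝕜] [NormedAddCommGroup X] [NormedSpace 𝕜 X] {T : X →L[𝕜] X}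

/-- The asymptotic size `limsup ‖T ^ n x‖` of an orbit; it is meaningful for bounded orbits, so in
particular when `T` is power bounded. -/
noncomputable def asymptoticNorm (T : X →L[𝕜] X) (x : X) : ℝ :=
  limsup (fun n : ℕ => ‖(T ^ n) x‖) atTop

lemma isCoboundedUnder_norm_pow (T : X →L[𝕜] X) (x : X) :
    IsCoboundedUnder (· ≤ ·) atTop fun n : ℕ => ‖(T ^ n) x‖ :=
  isCoboundedUnder_le_of_le atTop fun _ => norm_nonneg _

lemma PowerBounded.isBoundedUnder_norm_pow (hT : PowerBounded T) (x : X) :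
    IsBoundedUnder (· ≤ ·) atTop fun n : ℕ => ‖(T ^ n) x‖ := by
  obtain ⟨C, hC⟩ := hT
  exact isBoundedUnder_of ⟨C * ‖x‖, fun n => (T ^ n).le_of_opNorm_le (hC n) x⟩

lemma asymptoticNorm_map (T : X →L[𝕜] X) (x : X) :
    asymptoticNorm T (T x) = asymptoticNorm T x := by
  simpa only [asymptoticNorm, pow_succ, mul_apply_eq_comp] using
    limsup_nat_add (fun n : ℕ => ‖(T ^ n) x‖) 1

lemma asymptoticNorm_le {C : ℝ} (hC : ∀ n, ‖T ^ n‖ ≤ C) (x : X) :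
    asymptoticNorm T x ≤ C * ‖x‖ :=
  limsup_le_of_le (isCoboundedUnder_norm_pow T x)
    (.of_forall fun n => (T ^ n).le_of_opNorm_le (hC n) x)

lemma PowerBounded.norm_le_asymptoticNorm (hT : PowerBounded T) {m : ℕ → ℕ}
    (hm : Tendsto m atTop atTop) {x y : X} (hy : Tendsto (fun n => (T ^ m n) x) atTop (𝓝 y)) :
    ‖y‖ ≤ asymptoticNorm T x := by
  refine le_of_forall_gt_imp_ge_of_dense fun r hr => ?_
  have hlt := eventually_lt_of_limsup_lt hr (hT.isBoundedUnder_norm_pow x)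
  exact le_of_tendsto hy.norm ((hm.eventually hlt).mono fun _ => le_of_lt)

lemma PowerBounded.mem_vanishingSubspace_iff (hT : PowerBounded T) {x : X} :
    x ∈ vanishingSubspace T ↔ asymptoticNorm T x = 0 := by
  refine ⟨fun hx => ?_, fun hx => ?_⟩
  · simpa only [norm_zero] using! (Tendsto.norm hx).limsup_eq
  · refine tendsto_zero_iff_norm_tendsto_zero.2 (tendsto_order.2 ⟨fun r hr =>
      .of_forall fun n => hr.trans_le (norm_nonneg _), fun r hr => ?_⟩)
    exact eventually_lt_of_limsup_lt (hx.trans_lt hr) (hT.isBoundedUnder_norm_pow x)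

lemma PowerBounded.asymptoticNorm_add_le (hT : PowerBounded T) (x y : X) :
    asymptoticNorm T (x + y) ≤ asymptoticNorm T x + asymptoticNorm T y := by
  have hx := hT.isBoundedUnder_norm_pow x
  have hy := hT.isBoundedUnder_norm_pow y
  calc asymptoticNorm T (x + y)
      ≤ limsup ((fun n : ℕ => ‖(T ^ n) x‖) + fun n => ‖(T ^ n) y‖) atTop :=
        limsup_le_limsup (.of_forall fun n => by simpa only [map_add] using! norm_add_le _ _)
          (isCoboundedUnder_norm_pow T _) (isBoundedUnder_le_add hx hy)
    _ ≤ asymptoticNorm T x + asymptoticNorm T y :=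
        limsup_add_le (isBoundedUnder_of ⟨0, fun _ => norm_nonneg _⟩) hx
          (isCoboundedUnder_norm_pow T y) hy

lemma PowerBounded.asymptoticNorm_smul (hT : PowerBounded T) (c : 𝕜) (x : X) :
    asymptoticNorm T (c • x) = ‖c‖ * asymptoticNorm T x := by
  have hmul := (monotone_mul_left_of_nonneg (norm_nonneg c)).map_limsup_of_continuousAt _
    (by fun_prop) (hT.isBoundedUnder_norm_pow x) (isCoboundedUnder_norm_pow T x)
  simpa only [asymptoticNorm, map_smul, norm_smul] using! hmul.symm

/-- The asymptotic norm as a seminorm. -/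
noncomputable def PowerBounded.asymptoticSeminorm (hT : PowerBounded T) : Seminorm 𝕜 X :=
  .of (asymptoticNorm T) hT.asymptoticNorm_add_le hT.asymptoticNorm_smul

end AsymptoticNorm

section IsometricModel

universe u

variable {𝕜 : Type*} [RCLike 𝕜]

lemma exists_denseRange_norm_eq {E : Type u} [AddCommGroup E] [Module 𝕜 E] (p : Seminorm 𝕜 E) :
    ∃ (Y : Type u) (_ : NormedAddCommGroup Y) (_ : NormedSpace 𝕜 Y) (_ : CompleteSpace Y)
      (π : E →ₗ[𝕜] Y), DenseRange π ∧ ∀ x, ‖π x‖ = p x := by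
  let _ : SeminormedAddCommGroup E := p.toSeminormedAddCommGroup
  let _ : NormedSpace 𝕜 E := ⟨fun c x => (map_smul_eq_mul p c x).le⟩
  exact ⟨UniformSpace.Completion E, inferInstance, inferInstance, inferInstance,
    UniformSpace.Completion.toComplₗᵢ.toLinearMap, UniformSpace.Completion.denseRange_coe,
    UniformSpace.Completion.norm_coe⟩

variable {X : Type u} [NormedAddCommGroup X] [NormedSpace 𝕜 X] {Y : Type*} [NormedAddCommGroup Y]
  [NormedSpace 𝕜 Y] {T : X →L[𝕜] X} {S : Y →L[𝕜] Y} {π : X →L[𝕜] Y}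

/-- `S` is the isometry induced by `T` on a space `Y` in which the image of `X` under `π` is dense
and carries the asymptotic norm of `T`. -/
structure IsIsometricModel (T : X →L[𝕜] X) (S : Y →L[𝕜] Y) (π : X →L[𝕜] Y) : Prop where
  isometry : Isometry S
  denseRange : DenseRange π
  semiconj : Function.Semiconj π T S
  norm_map : ∀ x, ‖π x‖ = asymptoticNorm T x

theorem PowerBounded.exists_isIsometricModel (hT : PowerBounded T) :
    ∃ (Y : Type u) (_ : NormedAddCommGroup Y) (_ : NormedSpace 𝕜 Y) (_ : CompleteSpace Y)
      (S : Y →L[𝕜] Y) (π : X →L[𝕜] Y), IsIsometricModel T S π := by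
  obtain ⟨Y, _, _, _, π, hdense, hnorm⟩ := exists_denseRange_norm_eq hT.asymptoticSeminorm
  replace hnorm : ∀ x, ‖π x‖ = asymptoticNorm T x := hnorm
  have hmap : ∀ x, ‖π (T x)‖ = ‖π x‖ := fun x => by rw [hnorm, hnorm, asymptoticNorm_map]
  let S : Y →L[𝕜] Y := (π ∘ₗ (T : X →ₗ[𝕜] X)).extendOfNorm π
  have hS : ∀ x, S (π x) = π (T x) :=
    LinearMap.extendOfNorm_eq hdense ⟨1, fun x => (hmap x).le.trans (one_mul _).ge⟩
  have hSnorm : ∀ y, ‖S y‖ = ‖y‖ := fun y => hdense.induction_on y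
    (isClosed_eq S.continuous.norm continuous_norm) fun x => by rw [hS, hmap]
  obtain ⟨C, hC⟩ := hT
  exact ⟨Y, _, _, inferInstance, S, π.mkContinuous C fun x => (hnorm x).trans_le
    (asymptoticNorm_le hC x), AddMonoidHomClass.isometry_of_norm S hSnorm, hdense,
    fun x => (hS x).symm, hnorm⟩

lemma IsIsometricModel.mem_vanishingSubspace_iff (h : IsIsometricModel T S π)
    (hT : PowerBounded T) {x : X} : x ∈ vanishingSubspace T ↔ π x = 0 := by
  rw [hT.mem_vanishingSubspace_iff, ← h.norm_map, norm_eq_zero]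

lemma IsIsometricModel.isClosed_vanishingSubspace (h : IsIsometricModel T S π)
    (hT : PowerBounded T) : IsClosed (vanishingSubspace T : Set X) := by
  have hker : vanishingSubspace T = π.ker := Submodule.ext fun _ => h.mem_vanishingSubspace_iff hT
  exact hker ▸ π.isClosed_ker

lemma IsIsometricModel.orbitCompact (h : IsIsometricModel T S π) (hT : PowerBounded T)
    (hO : OrbitCompact T) : OrbitCompact S := by
  refine hO.of_semiconj h.isometry π h.semiconj fun y ε hε => ?_
  obtain ⟨x, hx⟩ := h.denseRange.exists_dist_lt y (lt_min hε one_pos)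
  have hxy : asymptoticNorm T x < ‖y‖ + 1 := by
    rw [← h.norm_map]
    have htri := norm_le_norm_add_norm_sub y (π x)
    rw [← dist_eq_norm] at htri
    linarith [hx.trans_le (min_le_right _ _)]
  obtain ⟨n, hn⟩ := (eventually_lt_of_limsup_lt hxy (hT.isBoundedUnder_norm_pow x)).exists
  refine ⟨n, (T ^ n) x, hn.le, ?_⟩
  rw [semiconj_pow h.semiconj, (isometry_pow h.isometry n).dist_eq, dist_comm]
  exact hx.trans_le (min_le_left _ _)

end IsometricModel

section Returning

variable {𝕜 X Y : Type*} [RCLike 𝕜] [NormedAddCommGroup X] [NormedSpace 𝕜 X]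
  [NormedAddCommGroup Y] [NormedSpace 𝕜 Y] {T : X →L[𝕜] X} {S : Y →L[𝕜] Y} {π : X →L[𝕜] Y}
  {r : ℕ → ℕ}

lemma isReturning_iff_mapClusterPt {a : X} :
    IsReturning T a ↔ MapClusterPt a atTop fun n : ℕ => (T ^ n) a := by
  rw [IsReturning, ← nonpos_iff_eq_zero, liminf_le_iff,
    Metric.nhds_basis_eball.mapClusterPt_iff_frequently]
  simp only [Metric.mem_eball, edist_eq_enorm_sub, gt_iff_lt]

lemma exists_tendsto_pow_apply_self [FiniteDimensional 𝕜 Y] (hS : Isometry S) :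
    ∃ r : ℕ → ℕ, Tendsto r atTop atTop ∧ ∀ y, Tendsto (fun n => (S ^ r n) y) atTop (𝓝 y) := by
  have : ProperSpace (Y →L[𝕜] Y) := FiniteDimensional.proper 𝕜 _
  have hball : ∀ n : ℕ, S ^ n ∈ Metric.closedBall (0 : Y →L[𝕜] Y) 1 := fun n => by
    rw [mem_closedBall_zero_iff]
    exact ContinuousLinearMap.opNorm_le_bound _ zero_le_one fun y =>
      (norm_pow_apply hS n y).le.trans (one_mul _).ge
  obtain ⟨U, -, m, hm, hU⟩ := (isCompact_closedBall (0 : Y →L[𝕜] Y) 1).tendsto_subseq hball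
  exact ⟨fun n => m (n + n) - m n, tendsto_atTop_mono (strictMono_le_add_self_sub hm) tendsto_id,
    fun y => tendsto_pow_sub_self hS hm
      (((ContinuousLinearMap.apply 𝕜 Y y).continuous.tendsto U).comp hU)⟩

/-- The subspace of all vectors which return along the times `r n`. Unlike the set of all
returning vectors, it is a subspace for trivial reasons. -/
def returningSubmodule (T : X →L[𝕜] X) (r : ℕ → ℕ) : Submodule 𝕜 X where
  carrier := {a | Tendsto (fun n => (T ^ r n) a) atTop (𝓝 a)}
  zero_mem' := by simp
  add_mem' ha hb := by simpa only [Set.mem_ofPred_eq, map_add] using Tendsto.add ha hb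
  smul_mem' c a ha := by simpa only [Set.mem_ofPred_eq, map_smul] using Tendsto.const_smul ha c

lemma mapsTo_returningSubmodule (T : X →L[𝕜] X) (r : ℕ → ℕ) :
    Set.MapsTo T (returningSubmodule T r) (returningSubmodule T r) := fun a ha =>
  ((T.continuous.tendsto a).comp ha).congr fun n =>
    DFunLike.congr_fun (pow_mul_comm' T (r n)).symm a

namespace IsIsometricModel

lemma mem_returningSubmodule_of_tendsto (h : IsIsometricModel T S π) (hT : PowerBounded T)
    (hr : ∀ y, Tendsto (fun n => (S ^ r n) y) atTop (𝓝 y)) {m : ℕ → ℕ}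
    (hm : Tendsto m atTop atTop) {x y : X} (hy : Tendsto (fun n => (T ^ m n) x) atTop (𝓝 y)) :
    y ∈ returningSubmodule T r := by
  refine tendsto_iff_norm_sub_tendsto_zero.2 (squeeze_zero (fun _ => norm_nonneg _) (fun n => ?_)
    (tendsto_iff_norm_sub_tendsto_zero.1 (hr (π x))))
  have hlim : Tendsto (fun i => (T ^ m i) ((T ^ r n) x - x)) atTop (𝓝 ((T ^ r n) y - y)) := by
    refine ((((T ^ r n).continuous.tendsto y).comp hy).sub hy).congr fun i => ?_
    rw [map_sub]
    exact congrArg (· - _) (DFunLike.congr_fun (pow_mul_comm T (r n) (m i)) x)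
  calc ‖(T ^ r n) y - y‖ ≤ asymptoticNorm T ((T ^ r n) x - x) := hT.norm_le_asymptoticNorm hm hlim
    _ = ‖(S ^ r n) (π x) - π x‖ := by rw [← h.norm_map, map_sub, semiconj_pow h.semiconj]

lemma mem_returningSubmodule_iff (h : IsIsometricModel T S π) (hT : PowerBounded T)
    (hrtop : Tendsto r atTop atTop) (hr : ∀ y, Tendsto (fun n => (S ^ r n) y) atTop (𝓝 y))
    {a : X} : a ∈ returningSubmodule T r ↔ IsReturning T a := by
  rw [isReturning_iff_mapClusterPt]
  refine ⟨fun ha => .of_comp hrtop (Tendsto.mapClusterPt ha), fun ha => ?_⟩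
  obtain ⟨m, hm, hma⟩ := ha.tendsto_subseq
  exact h.mem_returningSubmodule_of_tendsto hT hr hm.tendsto_atTop hma

lemma eq_zero_of_mem_returningSubmodule (h : IsIsometricModel T S π) (hT : PowerBounded T)
    (hrtop : Tendsto r atTop atTop) {a : X} (ha : a ∈ returningSubmodule T r) (h0 : π a = 0) :
    a = 0 := by
  have hle := hT.norm_le_asymptoticNorm hrtop ha
  rwa [← h.norm_map, h0, norm_zero, norm_le_zero_iff] at hle

lemma finiteDimensional_returningSubmodule [FiniteDimensional 𝕜 Y] (h : IsIsometricModel T S π)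
    (hT : PowerBounded T) (hrtop : Tendsto r atTop atTop) :
    FiniteDimensional 𝕜 (returningSubmodule T r) :=
  .of_injective ((π : X →ₗ[𝕜] Y) ∘ₗ (returningSubmodule T r).subtype) <|
    (injective_iff_map_eq_zero _).2 fun a ha =>
      Subtype.ext (h.eq_zero_of_mem_returningSubmodule hT hrtop a.2 ha)

lemma exists_mem_returningSubmodule_map_eq [FiniteDimensional 𝕜 Y] (h : IsIsometricModel T S π)
    (hT : PowerBounded T) (hO : OrbitCompact T)
    (hr : ∀ y, Tendsto (fun n => (S ^ r n) y) atTop (𝓝 y)) (x : X) :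
    ∃ a ∈ returningSubmodule T r, π a = π x := by
  have : CompleteSpace Y := FiniteDimensional.complete 𝕜 Y
  let M := (returningSubmodule T r).map (π : X →ₗ[𝕜] Y)
  have hM : IsClosed (M : Set Y) := M.closed_of_finiteDimensional
  have hSM : Set.MapsTo S M M := by
    rintro _ ⟨a, ha, rfl⟩
    exact ⟨T a, mapsTo_returningSubmodule T r ha, h.semiconj a⟩
  obtain ⟨C, hC⟩ := id hT
  obtain ⟨m, y, hm, hy⟩ := hO.exists_strictMono_tendsto_pow fun n =>
    (T ^ n).le_of_opNorm_le (hC n) x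
  have hyM : π y ∈ M :=
    ⟨y, h.mem_returningSubmodule_of_tendsto hT hr hm.tendsto_atTop hy, rfl⟩
  have hdist : Tendsto (fun n => dist ((S ^ m n) (π x)) (π y)) atTop (𝓝 0) := by
    rw [← tendsto_iff_dist_tendsto_zero]
    exact ((π.continuous.tendsto y).comp hy).congr fun n => semiconj_pow h.semiconj (m n) x
  have hinf : Metric.infDist (π x) M ≤ 0 := ge_of_tendsto' hdist fun n => by
    rw [← (h.orbitCompact hT hO).infDist_pow h.isometry hM hSM (m n) (π x)]
    exact Metric.infDist_le_dist_of_mem hyM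
  exact (hM.mem_iff_infDist_zero M.nonempty).2 (hinf.antisymm Metric.infDist_nonneg)

lemma isCompl_returningSubmodule [FiniteDimensional 𝕜 Y] (h : IsIsometricModel T S π)
    (hT : PowerBounded T) (hO : OrbitCompact T) (hrtop : Tendsto r atTop atTop)
    (hr : ∀ y, Tendsto (fun n => (S ^ r n) y) atTop (𝓝 y)) :
    IsCompl (vanishingSubspace T) (returningSubmodule T r) := by
  refine ⟨Submodule.disjoint_def.2 fun x hx hxL =>
    h.eq_zero_of_mem_returningSubmodule hT hrtop hxL ((h.mem_vanishingSubspace_iff hT).1 hx),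
    codisjoint_iff_le_sup.2 fun x _ => ?_⟩
  obtain ⟨a, ha, hax⟩ := h.exists_mem_returningSubmodule_map_eq hT hO hr x
  have hvanish : x - a ∈ vanishingSubspace T :=
    (h.mem_vanishingSubspace_iff hT).2 (by rw [map_sub, hax, sub_self])
  exact Submodule.mem_sup.2 ⟨x - a, hvanish, a, ha, sub_add_cancel x a⟩

end IsIsometricModel

end Returning

section Decomposition

variable {𝕜 X : Type*} [RCLike 𝕜] [NormedAddCommGroup X] [NormedSpace 𝕜 X] {T : X →L[𝕜] X}

lemma OccasionallyAttracting.exists_dist_pow_lt {K : Set X} (hK : OccasionallyAttracting T K)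
    {x : X} (hx : ‖x‖ ≤ 1) {ε : ℝ} (hε : 0 < ε) : ∃ n : ℕ, ∃ y ∈ K, dist ((T ^ n) x) y < ε := by
  obtain ⟨n, hn⟩ := (frequently_lt_of_liminf_lt (by isBoundedDefault)
    ((hK x hx).trans_lt (ENNReal.ofReal_pos.2 hε))).exists
  obtain ⟨y, hyK, hy⟩ := Metric.infEDist_lt_iff.1 hn
  exact ⟨n, y, hyK, edist_lt_ofReal.1 hy⟩

theorem OccasionallyAttracting.orbitCompact {K : Set X} (hKT : OccasionallyAttracting T K)
    (hK : IsCompact K) : OrbitCompact T := by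
  intro R x hx
  have hR : 0 < R + 1 := by linarith [(norm_nonneg _).trans (hx 0)]
  let c : 𝕜 := ((R + 1 : ℝ) : 𝕜)
  have hc : c ≠ 0 := RCLike.ofReal_ne_zero.2 hR.ne'
  have hball : ∀ n, ‖c⁻¹ • x n‖ ≤ 1 := fun n => by
    rw [norm_smul, norm_inv, RCLike.norm_ofReal, abs_of_pos hR, inv_mul_le_one₀ hR]
    linarith [hx n]
  choose k y hyK hy using fun n : ℕ =>
    hKT.exists_dist_pow_lt (hball n) (Nat.one_div_pos_of_nat (α := ℝ) (n := n))
  obtain ⟨z, -, φ, hφ, hz⟩ := hK.tendsto_subseq hyK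
  refine ⟨fun n => k (φ n), φ, c • z, hφ, ?_⟩
  have hclose : Tendsto (fun n => dist (y (φ n)) ((T ^ k (φ n)) (c⁻¹ • x (φ n)))) atTop (𝓝 0) :=
    squeeze_zero (fun _ => dist_nonneg) (fun n => dist_comm (y (φ n)) _ ▸ (hy (φ n)).le)
      (tendsto_one_div_add_atTop_nhds_zero_nat.comp hφ.tendsto_atTop)
  simpa only [map_smul, smul_inv_smul₀ hc] using (hz.congr_dist hclose).const_smul c

lemma mapsTo_vanishingSubspace (T : X →L[𝕜] X) :
    Set.MapsTo T (vanishingSubspace T) (vanishingSubspace T) := fun x hx => by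
  simpa only [Function.comp_def, pow_succ, mul_apply_eq_comp] using!
    Tendsto.comp hx (tendsto_add_atTop_nat 1)

lemma tendsto_infEDist_pow_zero {L : Submodule 𝕜 X} (hL : Set.MapsTo T L L)
    (hsup : Codisjoint (vanishingSubspace T) L) (x : X) :
    Tendsto (fun n : ℕ => Metric.infEDist ((T ^ n) x) L) atTop (𝓝 0) := by
  obtain ⟨x₀, hx₀, l, hl, rfl⟩ := Submodule.mem_sup.1 (hsup.eq_top ▸ Submodule.mem_top (x := x))
  have hlim : Tendsto (fun n : ℕ => ‖(T ^ n) x₀‖ₑ) atTop (𝓝 0) := by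
    simpa only [enorm_zero] using Tendsto.enorm hx₀
  refine tendsto_of_tendsto_of_tendsto_of_le_of_le tendsto_const_nhds hlim
    (fun _ => bot_le) fun n => ?_
  calc Metric.infEDist ((T ^ n) (x₀ + l)) L ≤ edist ((T ^ n) (x₀ + l)) ((T ^ n) l) :=
        Metric.infEDist_le_edist_of_mem (mapsTo_pow hL n hl)
    _ = ‖(T ^ n) x₀‖ₑ := by rw [edist_eq_enorm_sub, map_add, add_sub_cancel_right]

lemma coe_restrict_pow {F : Submodule 𝕜 X} (hF : Set.MapsTo T F F) (n : ℕ) (x : F) :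
    (((T.restrict hF) ^ n) x : X) = (T ^ n) (x : X) :=
  semiconj_pow (π := ((↑) : F → X)) (fun _ => rfl) n x

lemma decomposesAlong_of_isTopCompl {X₀ L : Submodule 𝕜 X} (hcompl : X₀.IsTopCompl L)
    (h₀ : Set.MapsTo T X₀ X₀) (hL : Set.MapsTo T L L) : DecomposesAlong T X₀ L :=
  ⟨hcompl, h₀, hL, fun n x₀ l => by rw [map_add, coe_restrict_pow, coe_restrict_pow]⟩

end Decomposition

theorem theorem2_general {𝕜 X : Type*} [RCLike 𝕜] [NormedAddCommGroup X] [NormedSpace 𝕜 X]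
    (T : X →L[𝕜] X) (hT : PowerBounded T)
    (hK : ∃ K : Set X, IsCompact K ∧ OccasionallyAttracting T K) :
    ∃ L : Submodule 𝕜 X,
      Set.MapsTo T L L ∧
      FiniteDimensional 𝕜 L ∧
      L = Submodule.span 𝕜 {a : X | IsReturning T a} ∧
      (∀ x : X, Tendsto (fun n : ℕ => Metric.infEDist ((T ^ n) x) (L : Set X)) atTop (𝓝 0)) ∧
      DecomposesAlong T (vanishingSubspace T) L := by
  obtain ⟨K, hK, hKT⟩ := hK
  have hO : OrbitCompact T := hKT.orbitCompact hK
  obtain ⟨Y, _, _, _, S, π, hS⟩ := hT.exists_isIsometricModel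
  have hYfd : FiniteDimensional 𝕜 Y := (hS.orbitCompact hT hO).finiteDimensional hS.isometry
  obtain ⟨r, hrtop, hr⟩ := exists_tendsto_pow_apply_self hS.isometry
  have hTL := mapsTo_returningSubmodule T r
  have hLfd := hS.finiteDimensional_returningSubmodule hT hrtop
  have hreturning : (returningSubmodule T r : Set X) = {a | IsReturning T a} :=
    Set.ext fun _ => hS.mem_returningSubmodule_iff hT hrtop hr
  have hcompl := hS.isCompl_returningSubmodule hT hO hrtop hr
  refine ⟨returningSubmodule T r, hTL, hLfd, ?_,
    tendsto_infEDist_pow_zero hTL hcompl.codisjoint, ?_⟩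
  · rw [← hreturning, Submodule.span_eq]
  · have htop := Submodule.IsCompl.isTopCompl_of_isClosed_of_finiteDimensional hcompl
      (hS.isClosed_vanishingSubspace hT)
    exact decomposesAlong_of_isTopCompl htop (mapsTo_vanishingSubspace T) hTL

theorem theorem2 {𝕜 X : Type*} [RCLike 𝕜] [NormedAddCommGroup X] [NormedSpace 𝕜 X]
    [CompleteSpace X] (T : X →L[𝕜] X) (hT : PowerBounded T)
    (hK : ∃ K : Set X, IsCompact K ∧ OccasionallyAttracting T K) :
    ∃ L : Submodule 𝕜 X,
      Set.MapsTo T L L ∧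
      FiniteDimensional 𝕜 L ∧
      L = Submodule.span 𝕜 {a : X | IsReturning T a} ∧
      (∀ x : X, Tendsto (fun n : ℕ => Metric.infEDist ((T ^ n) x) (L : Set X)) atTop (𝓝 0)) ∧
      DecomposesAlong T (vanishingSubspace T) L :=
  theorem2_general T hT hK
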